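/- Let $\lambda$ be a regular cardinal and let $\mathcal K$ be a (locally small) cocomplete category with a factorization system $(\mathcal E,\mathcal M)$: both classes contain the isomorphisms and are closed under composition, every morphism factors as an $\mathcal E$-morphism followed by an $\mathcal M$-morphism, and every commutative square from an $\mathcal E$-morphism to an $\mathcal M$-morphism has a unique diagonal. A *$\lambda$-directed colimit of $\mathcal M$-morphisms* is the colimit of a diagram indexed by a small $\lambda$-directed poset all of whose transition morphisms are in $\mathcal M$. Assume that $(\mathcal E,\mathcal M)$ is *$\lambda$-convenient*: 1. every object has, up to isomorphism, only a set of $\mathcal E$-quotients (i.e. $\mathcal E$-morphisms starting in it); 2. for every $\lambda$-directed colimit of $\mathcal M$-morphisms, the colimit cocone consists of $\mathcal M$-morphisms, and for every cocone of $\mathcal M$-morphisms on the diagram the induced morphism from the colimit is in $\mathcal M$. An object $A$ is *$\lambda$-generated w.r.t. $\mathcal M$* if $\mathcal K(A,-):\mathcal K\to\mathbf{Set}$ preserves $\lambda$-directed colimits of $\mathcal M$-morphisms; let $\mathrm{Gen}_\lambda(\mathcal K)$ be the full subcategory of these objects. Assume that $\mathcal K$ is *$\mathcal M$-locally $\lambda$-generated*: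 there is a set $\mathcal A$ of objects $\lambda$-generated w.r.t. $\mathcal M$ such that every object of $\mathcal K$ is a $\lambda$-directed colimit of objects from $\mathcal A$ and morphisms from $\mathcal M$. Then $\mathcal K$ is equivalent to the full subcategory of $\mathbf{Set}^{\mathrm{Gen}_\lambda(\mathcal K)^{\mathrm{op}}}$ consisting of the functors $H$ that preserve $\lambda$-small limits and send multiple pushouts of $\mathcal E$-morphisms to multiple pullbacks; that is, for every small family $(e_i:A\to B_i)_{i\in I}$ of $\mathcal E$-morphisms in $\mathrm{Gen}_\lambda(\mathcal K)$ and every colimit of this diagram in $\mathrm{Gen}_\lambda(\mathcal K)$, $H$ sends the colimit cocone to a limit cone. The equivalence is given, up to natural isomorphism, by the canonical functor sending an object $X$ to the restriction of $\mathcal K(-,X)$ to $\mathrm{Gen}_\lambda(\mathcal K)^{\mathrm{op}}$. -/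

import Mathlib

open CategoryTheory Limits Opposite

universe w u

namespace LocGen

/-- `(E, M)` is an (orthogonal) factorization system: both classes contain the isomorphisms and
are closed under composition, every morphism is an `E`-morphism followed by an `M`-morphism, and
every commutative square from an `E`-morphism to an `M`-morphism has a unique diagonal. -/
structure IsFactorizationSystem {K : Type u} [Category.{w} K] (E M : MorphismProperty K) :
    Prop where
  iso_le_left : MorphismProperty.isomorphisms K ≤ E
  iso_le_right : MorphismProperty.isomorphisms K ≤ M
  left_comp : E.IsStableUnderComposition
  right_comp : M.IsStableUnderComposition
  factorization : E.HasFactorization M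
  exists_unique_diagonal : ∀ {A B X Y : K} (e : A ⟶ B) (m : X ⟶ Y) (f : A ⟶ X) (g : B ⟶ Y),
    E e → M m → f ≫ m = e ≫ g → ∃! d : B ⟶ X, e ≫ d = f ∧ d ≫ m = g

/-- All the transition morphisms of the diagram `D` belong to `M`. -/
def IsDiagramOf {K : Type u} [Category.{w} K] (M : MorphismProperty K)
    {J : Type w} [Category.{w} J] (D : J ⥤ K) : Prop :=
  ∀ ⦃i j : J⦄ (f : i ⟶ j), M (D.map f)

/-- The objects `A` which are `κ`-generated w.r.t. `M`: the functor `Hom(A, -)` preserves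
`κ`-directed colimits of `M`-morphisms, i.e. colimits of diagrams of `M`-morphisms indexed by
(small) `κ`-directed posets. -/
def isGenerated {K : Type u} [Category.{w} K] (M : MorphismProperty K)
    (κ : Cardinal.{w}) [Fact κ.IsRegular] : ObjectProperty K := fun A ↦
  ∀ (J : Type w) [PartialOrder J] [IsCardinalFiltered J κ] (D : J ⥤ K),
    IsDiagramOf M D → PreservesColimit D (coyoneda.obj (op A))

/-- The factorization system `(E, M)` is `κ`-convenient. -/
structure IsConvenient {K : Type u} [Category.{w} K] (E M : MorphismProperty K)
    (κ : Cardinal.{w}) [Fact κ.IsRegular] : Prop where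
  /-- Every object has, up to isomorphism, only a set of `E`-quotients. -/
  cowellpowered : ∀ X : K,
    ObjectProperty.EssentiallySmall.{w} (fun q : Under X ↦ E q.hom)
  /-- The colimit cocone of a `κ`-directed diagram of `M`-morphisms consists of `M`-morphisms. -/
  cocone_mem : ∀ (J : Type w) [PartialOrder J] [IsCardinalFiltered J κ] (D : J ⥤ K),
    IsDiagramOf M D → ∀ (c : Cocone D), IsColimit c → ∀ j, M (c.ι.app j)
  /-- The morphism induced by a cocone of `M`-morphisms on such a diagram is in `M`. -/
  desc_mem : ∀ (J : Type w) [PartialOrder J] [IsCardinalFiltered J κ] (D : J ⥤ K),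
    IsDiagramOf M D → ∀ (c : Cocone D) (hc : IsColimit c) (s : Cocone D),
      (∀ j, M (s.ι.app j)) → M (hc.desc s)

/-- `K`, equipped with the factorization system `(E, M)`, is `M`-locally `κ`-generated. -/
structure IsLocallyGenerated {K : Type u} [Category.{w} K] (E M : MorphismProperty K)
    (κ : Cardinal.{w}) [Fact κ.IsRegular] : Prop where
  cocomplete : HasColimitsOfSize.{w, w} K
  factorizationSystem : IsFactorizationSystem E M
  convenient : IsConvenient E M κ
  /-- There is a set of objects `κ`-generated w.r.t. `M` such that every object is the colimit of
  a `κ`-directed diagram of objects in this set and `M`-morphisms. -/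
  exists_generators : ∃ P : ObjectProperty K, ObjectProperty.Small.{w} P ∧ P ≤ isGenerated M κ ∧
    ∀ X : K, ∃ (J : Type w) (_ : PartialOrder J) (_ : IsCardinalFiltered J κ) (D : J ⥤ K)
      (c : Cocone D), (∀ j, P (D.obj j)) ∧ IsDiagramOf M D ∧ Nonempty (IsColimit c) ∧ c.pt = X

/-- The full subcategory `Gen_κ(K)` of the objects that are `κ`-generated w.r.t. `M`. -/
abbrev Gen {K : Type u} [Category.{w} K] (M : MorphismProperty K)
    (κ : Cardinal.{w}) [Fact κ.IsRegular] :=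
  (isGenerated M κ).FullSubcategory

/-- The presheaves on `Gen_κ(K)` that preserve `κ`-small limits and send multiple pushouts of
`E`-morphisms to multiple pullbacks. A diagram is `κ`-small if it has fewer than `κ` morphisms;
a multiple pushout is a colimit of a small family of morphisms `A ⟶ B i` with common domain. -/
structure IsModel {K : Type u} [Category.{w} K] (E M : MorphismProperty K)
    (κ : Cardinal.{w}) [Fact κ.IsRegular] (H : (Gen M κ)ᵒᵖ ⥤ Type w) : Prop where
  preserves_small_limits : ∀ (J : Type w) [SmallCategory J],
    HasCardinalLT (Arrow J) κ → PreservesLimitsOfShape J H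
  multiple_pushouts : ∀ (I : Type w) (D : WidePushoutShape I ⥤ Gen M κ),
    (∀ i : I, E ((isGenerated M κ).ι.map (D.map (WidePushoutShape.Hom.init i)))) →
      ∀ c : Cocone D, IsColimit c → Nonempty (IsLimit (H.mapCone c.op))

/-- The category of models, as a full subcategory of the presheaves on `Gen_κ(K)`. -/
abbrev Models {K : Type u} [Category.{w} K] (E M : MorphismProperty K)
    (κ : Cardinal.{w}) [Fact κ.IsRegular] :=
  ObjectProperty.FullSubcategory (fun H : (Gen M κ)ᵒᵖ ⥤ Type w ↦ IsModel E M κ H)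

/-- The canonical functor from `K` to the presheaves on `Gen_κ(K)`, which sends `X` to the
restriction of `Hom(-, X)`. -/
abbrev canonical {K : Type u} [Category.{w} K] (M : MorphismProperty K)
    (κ : Cardinal.{w}) [Fact κ.IsRegular] : K ⥤ ((Gen M κ)ᵒᵖ ⥤ Type w) :=
  yoneda ⋙ (Functor.whiskeringLeft _ _ _).obj (isGenerated M κ).ι.op

end LocGen

namespace LocGen

variable {K : Type u} [Category.{w} K] {E M : MorphismProperty K}

/-! ### Consequences of unique diagonals -/

namespace IsFactorizationSystem

/-! Maps from generated objects into a `κ`-directed colimit of `M`-morphisms factor through a stage,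
so the generators make the canonical functor fully faithful.

For essential surjectivity, let `H` be a model. Its category of elements is `κ`-filtered because `H`
preserves `κ`-small limits, but its morphisms need not lie over `M`. The multiple pushout condition
glues all extensions of an element along `E`-quotients into a largest one
(`exists_largest_quotient`). It is reduced, since `E` consists of epimorphisms (`epi_of_left`).
Morphisms out of reduced elements lie over `M` (`right_of_isReduced`), and `H` is still the colimit
of its reduced elements (`nonempty_isColimit_reducedCocone`). The canonical functor preserves the
colimit of their underlying objects in `K`, so it sends that colimit to `H`. -/

theorem left_of_iso (h : IsFactorizationSystem E M) {A B : K} (f : A ⟶ B) [IsIso f] : E f :=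
  h.iso_le_left f (MorphismProperty.isomorphisms.infer_property f)

theorem hom_ext_diagonal (h : IsFactorizationSystem E M) {A B X Y : K} {e : A ⟶ B} {m : X ⟶ Y}
    (he : E e) (hm : M m) {d d' : B ⟶ X} (h₁ : e ≫ d = e ≫ d') (h₂ : d ≫ m = d' ≫ m) : d = d' :=
  (h.exists_unique_diagonal e m (e ≫ d) (d ≫ m) he hm (Category.assoc _ _ _)).unique
    ⟨rfl, rfl⟩ ⟨h₁.symm, h₂.symm⟩

/-- If `e` is in `E`, `m` is in `M` and `m` has a section `d` compatible with `e`, then `e ≫ m` is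
in `E`. -/
theorem left_of_section (h : IsFactorizationSystem E M) {A Q P : K} {e : A ⟶ Q} {m : Q ⟶ P}
    (he : E e) (hm : M m) {d : P ⟶ Q} (hd : e ≫ m ≫ d = e) (hdm : d ≫ m = 𝟙 P) : E (e ≫ m) := by
  have : m ≫ d = 𝟙 Q := h.hom_ext_diagonal he hm (by simpa using hd) (by simp [hdm])
  have : IsIso m := ⟨d, this, hdm⟩
  have := h.left_comp
  exact E.comp_mem _ _ he (h.left_of_iso m)

/-- Factor the leg at the vertex as `e ≫ m`. The diagonals against `m` glue to a section of `m`,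
which forces `m` to be invertible. -/
theorem left_of_isColimit_widePushout (h : IsFactorizationSystem E M) {I : Type w}
    {D : WidePushoutShape I ⥤ K} (hD : ∀ i, E (D.map (WidePushoutShape.Hom.init i)))
    {c : Cocone D} (hc : IsColimit c) : E (c.ι.app none) := by
  obtain ⟨Q, e, m, fac, he, hm⟩ := (h.factorization.nonempty_mapFactorizationData (c.ι.app none)).some
  choose d hd using fun i ↦ (h.exists_unique_diagonal (D.map (WidePushoutShape.Hom.init i)) m e
    (c.ι.app (some i)) (hD i) hm (by rw [fac, c.w])).exists
  obtain ⟨t, h₁, h₂⟩ : ∃ t : c.pt ⟶ Q, c.ι.app none ≫ t = e ∧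
      ∀ i, c.ι.app (some i) ≫ t = d i :=
    ⟨hc.desc (WidePushoutShape.mkCocone e d (fun i ↦ (hd i).1)), hc.fac _ none,
      fun i ↦ hc.fac _ (some i)⟩
  have h₃ : t ≫ m = 𝟙 c.pt := hc.hom_ext (by
    rintro (_ | i)
    · exact ((reassoc_of% h₁) m).trans (fac.trans (Category.comp_id _).symm)
    · exact ((reassoc_of% (h₂ i)) m).trans ((hd i).2.trans (Category.comp_id _).symm))
  rw [← fac]
  exact h.left_of_section he hm (((reassoc_of% fac) t).trans h₁) h₃

end IsFactorizationSystem

/-- If every object has only a set of `E`-quotients, then the morphisms in `E` are epimorphisms: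
otherwise the powers of a morphism `e` in the coslice category would have too many
morphisms to a fixed object. -/
theorem epi_of_left (hE : IsFactorizationSystem E M) [HasColimitsOfSize.{w, w} K]
    (hQ : ∀ X : K, ObjectProperty.EssentiallySmall.{w} (fun q : Under X ↦ E q.hom))
    {A B : K} (e : A ⟶ B) (he : E e) : Epi e := by
  refine ⟨fun {C} f g hfg ↦ ?_⟩
  by_contra hne
  have := hQ A
  obtain ⟨Q, _, -, hQE⟩ := ObjectProperty.EssentiallySmall.exists_small_le.{w}
    (fun q : Under A ↦ E q.hom)
  -- `I` collects all morphisms to `C` from representatives of the `E`-quotients of `A`. The pushout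
  -- of `I` copies of `e` is such a quotient, yet it has at least `2 ^ I` morphisms to `C`: choose
  -- `f` or `g` on each copy.
  let I : Type w := Σ s : Shrink.{w} (Subtype Q), ((equivShrink (Subtype Q)).symm s).1.right ⟶ C
  let D : WidePushoutShape I ⥤ K := WidePushoutShape.wideSpan A (fun _ ↦ B) (fun _ ↦ e)
  let c : Cocone D := colimit.cocone D
  have hc : IsColimit c := colimit.isColimit D
  have hP : E (c.ι.app none) := hE.left_of_isColimit_widePushout (fun i ↦ by simpa [D] using! he) hc
  obtain ⟨q, hq, ⟨i⟩⟩ := hQE (Under.mk (c.ι.app none)) hP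
  let ψ (S : Set I) : c.pt ⟶ C := by
    classical
    exact hc.desc (WidePushoutShape.mkCocone (F := D) (e ≫ f) (fun i ↦ if i ∈ S then f else g)
      (fun i ↦ by
        simp only [D, WidePushoutShape.wideSpan]
        split_ifs
        · rfl
        · exact hfg.symm))
  have hψ (S : Set I) (i : I) [Decidable (i ∈ S)] :
      c.ι.app (some i) ≫ ψ S = if i ∈ S then f else g :=
    (hc.fac _ (some i)).trans (by
      simp only [WidePushoutShape.mkCocone]
      congr)
  have hinj : Function.Injective ψ := by
    classical
    intro S T hST
    ext i
    have := (hψ S i).symm.trans (by rw [hST, hψ T i] : _ = if i ∈ T then f else g)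
    split_ifs at this <;> grind
  let j : c.pt ≅ q.right := (Under.forget A).mapIso i
  let φ (S : Set I) : I := ⟨equivShrink _ ⟨q, hq⟩, eqToHom (by simp) ≫ j.inv ≫ ψ S⟩
  refine Function.cantor_injective φ (fun S T hST ↦ hinj ?_)
  have h := eq_of_heq (Sigma.mk.inj hST).2
  rwa [cancel_epi, cancel_epi] at h

/-! ### Closure properties and smallness of the generated objects -/

variable {κ : Cardinal.{w}} [Fact κ.IsRegular]

/-- `Hom(c.pt, -)` is a `κ`-small limit of the functors `Hom(Y j, -)`, and such limits commute with
`κ`-filtered colimits of sets. -/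
theorem isGenerated_of_isColimit {J : Type w} [SmallCategory J] (hJ : HasCardinalLT (Arrow J) κ)
    {Y : J ⥤ K} {c : Cocone Y} (hc : IsColimit c) (hY : ∀ j, isGenerated M κ (Y.obj j)) :
    isGenerated M κ c.pt := by
  intro A _ _ D hD
  refine ⟨fun {s} hs ↦ ⟨?_⟩⟩
  have hc' : IsLimit (coyoneda.mapCone c.op) := isLimitOfPreserves _ hc.op
  exact Functor.Accessible.Limits.isColimitMapCocone (coyoneda.mapCone c.op)
    (fun Z ↦ isLimitOfPreserves ((evaluation K (Type w)).obj Z) hc') κ (by simpa) s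
    (fun k ↦ have := hY k.unop A D hD
      isColimitOfPreserves (coyoneda.obj (op (Y.obj k.unop))) hs)

theorem isClosedUnderColimitsOfShape_isGenerated {J : Type w} [SmallCategory J]
    (hJ : HasCardinalLT (Arrow J) κ) : (isGenerated M κ).IsClosedUnderColimitsOfShape J where
  colimitsOfShape_le := by
    rintro X ⟨hX⟩
    exact isGenerated_of_isColimit hJ hX.isColimit hX.prop_diag_obj

/-- The colimit legs are in `M`, so factorizations through a stage, and equalities at a stage, pass
from `A` to `B` by unique diagonals. -/
theorem isGenerated_of_left (hE : IsFactorizationSystem E M) (hc : IsConvenient E M κ)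
    {A B : K} (e : A ⟶ B) (he : E e) (hA : isGenerated M κ A) : isGenerated M κ B := by
  intro J _ _ D hD
  have := isFiltered_of_isCardinalFiltered J κ
  have := hA J D hD
  refine ⟨fun {s} hs ↦ ⟨Types.FilteredColimit.isColimitOf' _ _ (fun f ↦ ?_) (fun i d d' h ↦ ?_)⟩⟩
  · obtain ⟨j, g, hg⟩ := exists_hom_of_preservesColimit_coyoneda hs (e ≫ f)
    obtain ⟨d, -, hd⟩ := (hE.exists_unique_diagonal e (s.ι.app j) g f he
      (hc.cocone_mem J D hD s hs j) hg).exists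
    exact ⟨j, d, hd.symm⟩
  · change d ≫ s.ι.app i = d' ≫ s.ι.app i at h
    obtain ⟨j, a, ha⟩ := exists_eq_of_preservesColimit_coyoneda_self hs (e ≫ d) (e ≫ d')
      (by simp [h])
    refine ⟨j, a, hE.hom_ext_diagonal he (hc.cocone_mem J D hD s hs j) ?_ ?_⟩
    · simpa using ha
    · change (d ≫ D.map a) ≫ s.ι.app j = (d' ≫ D.map a) ≫ s.ι.app j
      simp [h]

theorem essentiallySmall_gen (hK : IsLocallyGenerated E M κ) :
    EssentiallySmall.{w} (Gen M κ) := by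
  obtain ⟨P, _, hP, hX⟩ := hK.exists_generators
  have : ObjectProperty.EssentiallySmall.{w} (isGenerated M κ) :=
    .of_le (Q := P.retractClosure) (fun X hXg ↦ by
      obtain ⟨J, _, _, D, c, hDP, hD, ⟨hc⟩, rfl⟩ := hX X
      have := hXg J D hD
      -- The identity factors through a stage, so a generated object is a retract of a generator.
      obtain ⟨j, p, hp⟩ := exists_hom_of_preservesColimit_coyoneda hc (𝟙 _)
      exact ⟨_, hDP j, ⟨⟨p, _, hp⟩⟩⟩)
  infer_instance

/-! ### The canonical functor is fully faithful with values in models -/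

theorem canonical_faithful (hK : IsLocallyGenerated E M κ) : (canonical M κ).Faithful := by
  obtain ⟨P, -, hP, hX⟩ := hK.exists_generators
  refine ⟨fun {X Y f g} hfg ↦ ?_⟩
  obtain ⟨J, _, _, D, c, hDP, hD, ⟨hc⟩, rfl⟩ := hX X
  exact hc.hom_ext (fun j ↦ ConcreteCategory.congr_hom
    (NatTrans.congr_app hfg (op ⟨D.obj j, hP _ (hDP j)⟩)) (c.ι.app j))

theorem canonical_full (hK : IsLocallyGenerated E M κ) : (canonical M κ).Full := by
  obtain ⟨P, -, hP, hX⟩ := hK.exists_generators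
  refine ⟨fun {X Y} φ ↦ ?_⟩
  obtain ⟨J, _, _, D, c, hDP, hD, ⟨hc⟩, rfl⟩ := hX X
  let G (j : J) : Gen M κ := ⟨D.obj j, hP _ (hDP j)⟩
  have hφ {A B : Gen M κ} (f : A.obj ⟶ B.obj) (x : B.obj ⟶ c.pt) :
      φ.app (op A) (f ≫ x) = f ≫ φ.app (op B) x :=
    NatTrans.naturality_apply φ (ObjectProperty.homMk (X := A) (Y := B) f).op x
  let s : Cocone D :=
    { pt := Y
      ι :=
        { app j := φ.app (op (G j)) (c.ι.app j)
          naturality i j f := by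
            have := hφ (A := G i) (B := G j) (D.map f) (c.ι.app j)
            rw [c.w] at this
            exact this.symm.trans (Category.comp_id _).symm } }
  refine ⟨hc.desc s, ?_⟩
  ext A a
  have := A.unop.property J D hD
  obtain ⟨j, p, rfl⟩ := exists_hom_of_preservesColimit_coyoneda (X := A.unop.obj) hc a
  have h₁ : (p ≫ c.ι.app j) ≫ hc.desc s = p ≫ s.ι.app j := by simp
  exact h₁.trans (hφ (A := A.unop) (B := G j) p (c.ι.app j)).symm

/-- The colimit taken in `K` is an `E`-quotient of the generated object at the vertex, hence itself
generated. Multiple pushouts of `E`-morphisms in `Gen M κ` are thus computed in `K`. -/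
theorem preservesColimit_ι_of_left (hK : IsLocallyGenerated E M κ) {I : Type w}
    (D : WidePushoutShape I ⥤ Gen M κ)
    (hD : ∀ i : I, E ((isGenerated M κ).ι.map (D.map (WidePushoutShape.Hom.init i)))) :
    HasColimit D ∧ PreservesColimit D (isGenerated M κ).ι := by
  have := hK.cocomplete
  have h := hK.factorizationSystem.left_of_isColimit_widePushout (D := D ⋙ (isGenerated M κ).ι) hD
    (colimit.isColimit _)
  have : CreatesColimit D (isGenerated M κ).ι := createsColimitFullSubcategoryInclusion D
    (isGenerated_of_left hK.factorizationSystem hK.convenient _ h (D.obj none).property)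
  exact ⟨hasColimit_of_created D (isGenerated M κ).ι, inferInstance⟩

theorem isModel_canonical (hK : IsLocallyGenerated E M κ) (X : K) :
    IsModel E M κ ((canonical M κ).obj X) where
  preserves_small_limits J _ hJ := by
    have := hK.cocomplete
    have := isClosedUnderColimitsOfShape_isGenerated (M := M) (J := Jᵒᵖ) (κ := κ) (by simpa)
    have : PreservesLimitsOfShape J (isGenerated M κ).ι.op :=
      preservesLimitsOfShape_op _ _
    exact inferInstanceAs (PreservesLimitsOfShape J ((isGenerated M κ).ι.op ⋙ yoneda.obj X))
  multiple_pushouts I D hD c hc := by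
    have := (preservesColimit_ι_of_left hK D hD).2
    exact ⟨isLimitOfPreserves (yoneda.obj X)
      (isColimitOfPreserves (isGenerated M κ).ι hc).op⟩

/-! ### Elements of a model and their reduction -/

variable {H : (Gen M κ)ᵒᵖ ⥤ Type w}

/-- The projection from the (opposite of the) category of elements of a presheaf on `Gen_κ(K)`. -/
abbrev elementsProj (H : (Gen M κ)ᵒᵖ ⥤ Type w) : H.Elementsᵒᵖ ⥤ Gen M κ :=
  (CategoryOfElements.π H).leftOp

/-- The functor sending an element of a presheaf on `Gen_κ(K)` to the underlying object of `K`. -/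
abbrev elementsObj (H : (Gen M κ)ᵒᵖ ⥤ Type w) : H.Elementsᵒᵖ ⥤ K :=
  elementsProj H ⋙ (isGenerated M κ).ι

/-- The element `H(f)(b)` of `H`, where `b` is an element over the target of `f`. -/
def restrict (y : H.Elementsᵒᵖ) {A : Gen M κ} (f : A ⟶ (elementsProj H).obj y) : H.Elementsᵒᵖ :=
  op ⟨op A, H.map f.op y.unop.2⟩

/-- The morphism of elements lying over `f`. -/
def restrictHom (y : H.Elementsᵒᵖ) {A : Gen M κ} (f : A ⟶ (elementsProj H).obj y) :
    restrict y f ⟶ y :=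
  Quiver.Hom.op ⟨f.op, rfl⟩

/-- Constructor for morphisms of elements. -/
def elementsHom {x y : H.Elementsᵒᵖ} (f : (elementsProj H).obj x ⟶ (elementsProj H).obj y)
    (hf : H.map f.op y.unop.2 = x.unop.2) : x ⟶ y :=
  Quiver.Hom.op ⟨f.op, hf⟩

theorem map_elementsHom {x y : H.Elementsᵒᵖ} (f : x ⟶ y) :
    H.map ((elementsProj H).map f).op y.unop.2 = x.unop.2 :=
  f.unop.2

theorem map_comp_op_apply (H : (Gen M κ)ᵒᵖ ⥤ Type w) {A B C : Gen M κ} (f : A ⟶ B) (g : B ⟶ C)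
    (z : H.obj (op C)) : H.map (f ≫ g).op z = H.map f.op (H.map g.op z) := by
  simp

theorem map_hom_inv_op_apply (H : (Gen M κ)ᵒᵖ ⥤ Type w) {A B : Gen M κ} (i : A ≅ B)
    (z : H.obj (op A)) : H.map i.hom.op (H.map i.inv.op z) = z := by
  rw [← map_comp_op_apply, i.hom_inv_id]
  simp

theorem elementsHom_ext {x y : H.Elementsᵒᵖ} {f g : x ⟶ y}
    (h : (elementsObj H).map f = (elementsObj H).map g) : f = g := by
  apply Quiver.Hom.unop_inj
  apply CategoryOfElements.ext
  apply Quiver.Hom.unop_inj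
  ext
  exact h

instance : (elementsObj H).Faithful where
  map_injective := elementsHom_ext

/-- An element of `H` is reduced if it does not extend along a proper `E`-quotient. -/
def isReduced (E : MorphismProperty K) (H : (Gen M κ)ᵒᵖ ⥤ Type w) :
    ObjectProperty H.Elementsᵒᵖ := fun x ↦
  ∀ ⦃y : H.Elementsᵒᵖ⦄ (q : x ⟶ y), E ((elementsObj H).map q) → IsIso q

theorem isCardinalFiltered_elements (hK : IsLocallyGenerated E M κ) (hH : IsModel E M κ H) :
    IsCardinalFiltered H.Elementsᵒᵖ κ where
  nonempty_cocone {A _} F hA := by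
    have := hK.cocomplete
    have := isClosedUnderColimitsOfShape_isGenerated (M := M) hA
    have := hH.preserves_small_limits Aᵒᵖ (by simpa)
    have := hasColimitsOfShape_of_equivalence (C := Gen M κ) (opOpEquivalence A).symm
    have : HasLimitsOfShape Aᵒᵖ (Gen M κ)ᵒᵖ := hasLimitsOfShape_op_of_hasColimitsOfShape
    have : HasColimitsOfShape A H.Elementsᵒᵖ := hasColimitsOfShape_op_of_hasLimitsOfShape
    exact ⟨colimit.cocone F⟩

/-- Every element has a largest `E`-quotient. -/
theorem exists_largest_quotient (hK : IsLocallyGenerated E M κ) (hH : IsModel E M κ H)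
    (x : H.Elementsᵒᵖ) : ∃ (t : H.Elementsᵒᵖ) (p : x ⟶ t), E ((elementsObj H).map p) ∧
      ∀ ⦃y : H.Elementsᵒᵖ⦄ (q : x ⟶ y), E ((elementsObj H).map q) →
        ∃ s : y ⟶ t, q ≫ s = p := by
  let A : Gen M κ := (elementsProj H).obj x
  have hE := hK.factorizationSystem
  have := hK.convenient.cowellpowered A.obj
  obtain ⟨Q, _, hQ, hQE⟩ := ObjectProperty.EssentiallySmall.exists_small_le.{w}
    (fun q : Under A.obj ↦ E q.hom)
  let r (s : Shrink.{w} (Subtype Q)) : Under A.obj := ((equivShrink (Subtype Q)).symm s).1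
  have hr (s) : E (r s).hom := hQ _ ((equivShrink (Subtype Q)).symm s).2
  let B (s : Shrink.{w} (Subtype Q)) : Gen M κ :=
    ⟨(r s).right, isGenerated_of_left hE hK.convenient _ (hr s) A.property⟩
  let e (s : Shrink.{w} (Subtype Q)) : A ⟶ B s := ObjectProperty.homMk (r s).hom
  -- One index for each representative quotient together with an extension of the element `x` along
  -- it. These extensions form a compatible family, so they glue to one element `z` over the
  -- multiple pushout.
  let I : Type w := Σ s, { b : H.obj (op (B s)) // H.map (e s).op b = x.unop.2 }
  let D : WidePushoutShape I ⥤ Gen M κ :=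
    WidePushoutShape.wideSpan A (fun i ↦ B i.1) (fun i ↦ e i.1)
  have hD (i : I) : E ((isGenerated M κ).ι.map (D.map (WidePushoutShape.Hom.init i))) := hr i.1
  obtain ⟨_, _⟩ := preservesColimit_ι_of_left hK D hD
  let c := colimit.cocone D
  have hc : IsColimit c := colimit.isColimit D
  obtain ⟨hl⟩ := hH.multiple_pushouts I D hD c hc
  let σ : (D.op ⋙ H).sections :=
    ⟨fun j ↦ match j with
      | ⟨none⟩ => x.unop.2
      | ⟨some i⟩ => i.2.1, by
      rintro ⟨j⟩ ⟨j'⟩ ⟨f⟩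
      change WidePushoutShape.Hom j' j at f
      cases f with
      | id => exact ConcreteCategory.congr_hom ((D.op ⋙ H).map_id _) _
      | init i => exact i.2.2⟩
  let z : H.obj (op c.pt) := (Types.isLimitEquivSections hl).symm σ
  have hz (j : WidePushoutShape I) : H.map (c.ι.app j).op z = σ.1 (op j) :=
    Types.isLimitEquivSections_symm_apply hl σ (op j)
  refine ⟨op ⟨op c.pt, z⟩, elementsHom (c.ι.app none) (hz none),
    hE.left_of_isColimit_widePushout (D := D ⋙ (isGenerated M κ).ι) hD
      (isColimitOfPreserves (isGenerated M κ).ι hc), fun y q hq ↦ ?_⟩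
  obtain ⟨q', hq', ⟨i⟩⟩ := hQE (Under.mk ((elementsObj H).map q)) hq
  obtain ⟨s, rfl⟩ : ∃ s, q' = r s := ⟨equivShrink _ ⟨q', hq'⟩, by simp [r]⟩
  let j : (elementsProj H).obj y ≅ B s := ObjectProperty.isoMk _ ((Under.forget _).mapIso i)
  have hj : (elementsProj H).map q ≫ j.hom = e s := by
    ext
    exact Under.w i.hom
  have hj' : e s ≫ j.inv = (elementsProj H).map q := by simp [← hj]
  let k : I := ⟨s, H.map j.inv.op y.unop.2, by
    rw [← map_elementsHom q, ← hj', op_comp, Functor.map_comp]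
    rfl⟩
  let ρ : B s ⟶ c.pt := c.ι.app (some k)
  have hρ : e s ≫ ρ = c.ι.app none := c.w (WidePushoutShape.Hom.init k)
  refine ⟨elementsHom (j.hom ≫ ρ) ?_, elementsHom_ext ?_⟩
  · exact (map_comp_op_apply H j.hom ρ z).trans
      ((congrArg (H.map j.hom.op) (hz (some k))).trans (map_hom_inv_op_apply H j _))
  · rw [← hj, Category.assoc] at hρ
    have h := congrArg InducedCategory.Hom.hom hρ
    exact h

/-- For the largest quotient `p : x ⟶ t` and a further quotient `q` of `t`, maximality gives `s`
with `p ≫ q ≫ s = p`. Cancelling epimorphisms makes `s` inverse to `q`. -/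
theorem exists_isReduced (hK : IsLocallyGenerated E M κ) (hH : IsModel E M κ H)
    (x : H.Elementsᵒᵖ) : ∃ (t : H.Elementsᵒᵖ) (p : x ⟶ t), E ((elementsObj H).map p) ∧
      isReduced E H t := by
  have := hK.cocomplete
  have := hK.factorizationSystem.left_comp
  have hepi {x y : H.Elementsᵒᵖ} (q : x ⟶ y) (hq : E ((elementsObj H).map q)) : Epi q :=
    have := epi_of_left hK.factorizationSystem hK.convenient.cowellpowered _ hq
    (elementsObj H).epi_of_epi_map this
  obtain ⟨t, p, hp, ht⟩ := exists_largest_quotient hK hH x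
  refine ⟨t, p, hp, fun y q hq ↦ ?_⟩
  obtain ⟨s, hs⟩ := ht (p ≫ q) (by rw [Functor.map_comp]; exact E.comp_mem _ _ hp hq)
  have := hepi p hp
  have := hepi q hq
  have hqs : q ≫ s = 𝟙 t := by
    rw [← cancel_epi p, ← Category.assoc, hs, Category.comp_id]
  exact ⟨s, hqs, by rw [← cancel_epi q, reassoc_of% hqs, Category.comp_id]⟩

/-- Restricting `y` along the `M`-part of `f` turns the `E`-part into an `E`-quotient of the element
`x`, hence an isomorphism. -/
theorem right_of_isReduced (hK : IsLocallyGenerated E M κ) {x y : H.Elementsᵒᵖ}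
    (hx : isReduced E H x) (f : x ⟶ y) : M ((elementsObj H).map f) := by
  have hE := hK.factorizationSystem
  obtain ⟨Z, e, m, fac, he, hm⟩ :=
    (hE.factorization.nonempty_mapFactorizationData ((elementsObj H).map f)).some
  let Z' : Gen M κ := ⟨Z, isGenerated_of_left hE hK.convenient e he
    ((elementsProj H).obj x).property⟩
  let m' : Z' ⟶ (elementsProj H).obj y := ObjectProperty.homMk m
  let e' : (elementsProj H).obj x ⟶ Z' := ObjectProperty.homMk e
  have fac' : e' ≫ m' = (elementsProj H).map f := by
    ext
    exact fac
  let q : x ⟶ restrict y m' := elementsHom e' (by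
    rw [← map_elementsHom f, ← fac', op_comp, Functor.map_comp]
    rfl)
  have : IsIso q := hx q he
  have : IsIso e := inferInstanceAs (IsIso ((elementsObj H).map q))
  have := hE.right_comp
  rw [← fac]
  exact M.comp_mem _ _ (hE.iso_le_right e (MorphismProperty.isomorphisms.infer_property e)) hm

/-- Filteredness completes `e` and `f` to a commutative square whose side out of `y` lies over `M`;
the extension is its diagonal. -/
theorem exists_extension_of_isReduced (hK : IsLocallyGenerated E M κ) (hH : IsModel E M κ H)
    {x t y : H.Elementsᵒᵖ} (e : x ⟶ t) (he : E ((elementsObj H).map e)) (hy : isReduced E H y)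
    (f : x ⟶ y) : ∃ d : t ⟶ y, e ≫ d = f := by
  have := isCardinalFiltered_elements hK hH
  have := isFiltered_of_isCardinalFiltered H.Elementsᵒᵖ κ
  obtain ⟨r, g, h, hgh⟩ := IsFiltered.span e f
  obtain ⟨d, hd₁, hd₂⟩ := (hK.factorizationSystem.exists_unique_diagonal ((elementsObj H).map e)
    ((elementsObj H).map h) ((elementsObj H).map f) ((elementsObj H).map g) he
    (right_of_isReduced hK hy h) (by rw [← Functor.map_comp, ← Functor.map_comp, hgh])).exists
  let d' : (elementsProj H).obj t ⟶ (elementsProj H).obj y := ObjectProperty.homMk d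
  have hd' : d' ≫ (elementsProj H).map h = (elementsProj H).map g := by
    ext
    exact hd₂
  refine ⟨elementsHom d' ?_, elementsHom_ext hd₁⟩
  rw [← map_elementsHom g, ← map_elementsHom h, ← hd', op_comp, Functor.map_comp]
  rfl

theorem isCardinalFiltered_reduced (hK : IsLocallyGenerated E M κ) (hH : IsModel E M κ H) :
    IsCardinalFiltered (isReduced E H).FullSubcategory κ where
  nonempty_cocone {A _} F hA := by
    have := isCardinalFiltered_elements hK hH
    let c := IsCardinalFiltered.cocone (F ⋙ (isReduced E H).ι) hA
    obtain ⟨t, p, -, ht⟩ := exists_isReduced hK hH c.pt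
    exact ⟨{
      pt := ⟨t, ht⟩
      ι :=
        { app a := ObjectProperty.homMk (c.ι.app a ≫ p)
          naturality a b f := by
            ext
            have := c.w_assoc f p
            simpa using this } }⟩

theorem essentiallySmall_reduced (hK : IsLocallyGenerated E M κ) :
    EssentiallySmall.{w} (isReduced E H).FullSubcategory := by
  have := essentiallySmall_gen hK
  have : EssentiallySmall.{w} H.Elements :=
    (essentiallySmall_congr (CategoryOfElements.structuredArrowEquivalence H)).2 inferInstance
  have : ObjectProperty.EssentiallySmall.{w} (isReduced E H) := .of_le le_top
  infer_instance

/-- A presheaf `H` on `Gen_κ(K)` as a cocone over the diagram of its reduced elements. -/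
def reducedCocone (E : MorphismProperty K) (H : (Gen M κ)ᵒᵖ ⥤ Type w) :
    Cocone ((isReduced E H).ι ⋙ elementsObj H ⋙ canonical M κ) where
  pt := H
  ι :=
    { app x :=
        { app B := ↾fun f ↦ H.map (ObjectProperty.homMk f : B.unop ⟶ _).op x.obj.unop.2
          naturality B C g := by
            ext f
            have : (ObjectProperty.homMk (g.unop.hom ≫ f) : C.unop ⟶ (elementsProj H).obj x.obj) =
              g.unop ≫ ObjectProperty.homMk f := rfl
            change H.map (ObjectProperty.homMk (g.unop.hom ≫ f)).op _ = H.map g (H.map _ _)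
            rw [this, op_comp, Functor.map_comp]
            rfl }
      naturality x y g := by
        ext B f
        have : (ObjectProperty.homMk (f ≫ (elementsObj H).map g.hom) :
            B.unop ⟶ (elementsProj H).obj y.obj) =
          ObjectProperty.homMk f ≫ (elementsProj H).map g.hom := rfl
        change H.map (ObjectProperty.homMk (f ≫ (elementsObj H).map g.hom)).op _ = H.map _ _
        rw [this, op_comp, Functor.map_comp, ← map_elementsHom g.hom]
        rfl }

/-! ### Recovering a model from its reduced elements -/

theorem nonempty_isColimit_reducedCocone (hK : IsLocallyGenerated E M κ) (hH : IsModel E M κ H) :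
    Nonempty (IsColimit (reducedCocone E H)) := by
  refine ⟨evaluationJointlyReflectsColimits _ (fun B ↦
    Types.FilteredColimit.isColimitOf _ _ (fun b ↦ ?_) (fun x y f g hfg ↦ ?_))⟩
  · obtain ⟨t, p, -, ht⟩ := exists_isReduced hK hH (op ⟨B, b⟩)
    exact ⟨⟨t, ht⟩, (elementsObj H).map p, (map_elementsHom p).symm⟩
  · let f' : B.unop ⟶ (elementsProj H).obj x.obj := ObjectProperty.homMk f
    let g' : B.unop ⟶ (elementsProj H).obj y.obj := ObjectProperty.homMk g
    have hfg' : H.map g'.op y.obj.unop.2 = H.map f'.op x.obj.unop.2 := hfg.symm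
    -- Both `f` and `g` restrict to the same element over `B`. They extend along its reduction `t`,
    -- and filteredness of the reduced elements merges the two extensions.
    obtain ⟨t, p, hp, ht⟩ := exists_isReduced hK hH (restrict x.obj f')
    obtain ⟨d, hd⟩ := exists_extension_of_isReduced hK hH p hp x.property (restrictHom x.obj f')
    obtain ⟨d', hd'⟩ := exists_extension_of_isReduced hK hH p hp y.property
      (elementsHom g' hfg' : restrict x.obj f' ⟶ y.obj)
    have := isCardinalFiltered_reduced hK hH
    have := isFiltered_of_isCardinalFiltered (isReduced E H).FullSubcategory κ
    obtain ⟨z, a, b, hab⟩ := IsFiltered.span (C := (isReduced E H).FullSubcategory)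
      (i := ⟨t, ht⟩) (j := x) (j' := y) (ObjectProperty.homMk d) (ObjectProperty.homMk d')
    refine ⟨z, a, b, ?_⟩
    have h : d ≫ a.hom = d' ≫ b.hom := congrArg InducedCategory.Hom.hom hab
    have h' : restrictHom x.obj f' ≫ a.hom = elementsHom g' hfg' ≫ b.hom := by
      rw [← hd, ← hd', Category.assoc, Category.assoc, h]
    exact congrArg (elementsObj H).map h'

theorem exists_iso_canonical (hK : IsLocallyGenerated E M κ) (hH : IsModel E M κ H) :
    ∃ X : K, Nonempty ((canonical M κ).obj X ≅ H) := by
  have := hK.cocomplete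
  have := essentiallySmall_reduced (H := H) hK
  have := isCardinalFiltered_reduced hK hH
  let e := equivSmallModel.{w} (isReduced E H).FullSubcategory
  have := IsCardinalFiltered.of_equivalence κ e
  -- `isGenerated` only concerns diagrams indexed by posets, so the filtered category is replaced by
  -- a `κ`-directed poset along a final functor.
  obtain ⟨J, _, _, F, _⟩ := IsCardinalFiltered.exists_cardinal_directed
    (SmallModel.{w} (isReduced E H).FullSubcategory) κ
  let G : J ⥤ (isReduced E H).FullSubcategory := F ⋙ e.inverse
  let D : J ⥤ K := G ⋙ (isReduced E H).ι ⋙ elementsObj H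
  have hD : IsDiagramOf M D := fun i j f ↦
    right_of_isReduced hK (G.obj i).property (G.map f).hom
  have h₁ : IsColimit ((canonical M κ).mapCocone (colimit.cocone D)) :=
    evaluationJointlyReflectsColimits _ (fun B ↦
      have := B.unop.property J D hD
      isColimitOfPreserves (coyoneda.obj (op B.unop.obj)) (colimit.isColimit D))
  obtain ⟨h⟩ := nonempty_isColimit_reducedCocone hK hH
  have : G.Final := inferInstance
  have h₂ : IsColimit ((reducedCocone E H).whisker G) :=
    (Functor.Final.isColimitWhiskerEquiv G _).symm h
  exact ⟨colimit D, ⟨IsColimit.coconePointUniqueUpToIso h₁ h₂⟩⟩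

end LocGen

theorem mainTheorem9 {K : Type u} [Category.{w} K] (E M : MorphismProperty K)
    (κ : Cardinal.{w}) [Fact κ.IsRegular] (hK : LocGen.IsLocallyGenerated E M κ) :
    ∃ e : K ≌ LocGen.Models E M κ,
      Nonempty (e.functor ⋙ ObjectProperty.ι _ ≅ LocGen.canonical M κ) := by
  let F : K ⥤ LocGen.Models E M κ :=
    ObjectProperty.lift _ (LocGen.canonical M κ) (LocGen.isModel_canonical hK)
  have := LocGen.canonical_faithful hK
  have := LocGen.canonical_full hK
  have : F.Faithful := inferInstance
  have : F.Full := inferInstance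
  have : F.EssSurj := ⟨fun H ↦ by
    obtain ⟨X, ⟨i⟩⟩ := LocGen.exists_iso_canonical hK H.property
    exact ⟨X, ⟨ObjectProperty.isoMk _ i⟩⟩⟩
  have : F.IsEquivalence := { }
  exact ⟨F.asEquivalence, ⟨Iso.refl _⟩⟩
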